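/- Let $q$ be a prime power, $k\ge 4$ and $n\ge 2k+2$. For subspaces $X,Y$ of $\mathbb F_q^n$ let $d_I(X,Y)=\max\{\dim X,\dim Y\}-\dim(X\cap Y)$ be the injection distance. An $(n,M,d,k)_q$ code is a set of $M$ subspaces of $\mathbb F_q^n$ of dimension $k$ for which the minimum of $d_I(X,Y)$ over distinct codewords $X,Y$ is $d$. For a $k$-dimensional subspace $X$ of $\mathbb F_q^n$ let $\mathrm{RE}(X)$ be its $k\times n$ generator matrix in reduced row echelon form. The identifying vector $v(X)\in\{0,1\}^n$ has its ones exactly at the pivot columns of $\mathrm{RE}(X)$, and the Ferrers tableaux form $\mathcal F(X)$ is obtained from $\mathrm{RE}(X)$ by deleting the pivot columns and, in each row, the zeros to the left of the leading one. The set of positions (row, remaining column to the right of the pivot of that row) is the Ferrers diagram $\mathcal F_v$, which depends only on $v=v(X)$. For $0\le i\le d-1$ let $w_i$ be the number of dots of $\mathcal F_v$ that are neither in the first $i$ rows nor in the rightmost $d-1-i$ columns. An FDMRD code for $v$ of distance $d$ is a linear space of $k\times(n-k)$ matrices over $\mathbb F_q$ that vanish outside $\mathcal F_v$, in which any two distinct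 matrices $A,B$ satisfy $\operatorname{rank}(A-B)\ge d$, and whose dimension is $\min_{0\le i\le d-1}w_i$. The corresponding lifted code is the set of all $k$-dimensional subspaces $X$ of $\mathbb F_q^n$ with $v(X)=v$ whose $\mathcal F(X)$ is given by the entries on $\mathcal F_v$ of a matrix of the FDMRD code. Let $O_{n-k}\subset\{0,1\}^{n-k}$ consist of the vectors $v_i$, $1\le i\le\lfloor\frac{n-k}2\rfloor$, with $v_i(j)=1$ if and only if $\lceil j/2\rceil=i$, and let $\bar O_k\subset\{0,1\}^k$ consist of the vectors $u_i$, $1\le i\le\lfloor\frac k2\rfloor$, with $u_i(j)=0$ if and only if $\lceil\frac{k-j+1}2\rceil=i$. Let $$\mathcal A=\{(1\cdots1\,\|\,0\cdots0)\}\cup\{(u\,\|\,v): u\in\bar O_k,\ v\in O_{n-k}\}\subset\{0,1\}^n,$$ where the prefixes have length $k$ and the suffixes length $n-k$. **Theorem (Construction B).** For every vector in $\mathcal A$ there is an FDMRD code of distance $2$. Choose one for each vector in $\mathcal A$, and let $D$ be any $(n-k,M,2,k)_q$ code. Let $C$ be the union of the lifted codes of all the chosen FDMRD codes and of the set of the subspaces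 $\{0\}^k\times Y$ of $\mathbb F_q^n$ with $Y\in D$. Then, whatever the choices, $C$ has minimum injection distance exactly $2$ and cardinality $$q^{(k-1)(n-k)}+M+\left(\sum_{i=0}^{\lfloor\frac{k-3}2\rfloor}q^{(k-3)(n-k)-4i}+\epsilon(k-1)\,q^{(k-3)(n-k-2)}\right)\sum_{i=0}^{\lfloor\frac{n-k}2\rfloor-1}q^{2(2i+\epsilon(n-k))},$$ where $\epsilon(i)=1$ if $i$ is odd and $\epsilon(i)=0$ if $i$ is even. In particular, if $D$ is the largest known $(n-k,M,2,k)_q$ code, then $M=A^*_q(n-k,2,k)$ is its size. -/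

import Mathlib

namespace SubspaceCode

/-- The Grassmannian: all `k`-dimensional subspaces of `K^n`. -/
def grassmannian (K : Type*) [Field K] (n k : ℕ) : Set (Submodule K (Fin n → K)) :=
  {X | Module.finrank K X = k}

/-- The injection distance `max (dim X) (dim Y) - dim (X ∩ Y)`. The subtraction never truncates. -/
noncomputable def injectionDist {K : Type*} [Field K] {n : ℕ}
    (X Y : Submodule K (Fin n → K)) : ℕ :=
  max (Module.finrank K X) (Module.finrank K Y)
    - Module.finrank K (X ⊓ Y : Submodule K (Fin n → K))

/-- `C` is an `(n, M, d, k)_q` constant-dimension code over the field `K` with `q` elements: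
a set of exactly `M` subspaces of `K^n` of dimension `k`, such that `d` is the minimum of the
injection distances of two different codewords (in particular there are two of them). -/
def IsCDCode {K : Type*} [Field K] (n M d k : ℕ) (C : Set (Submodule K (Fin n → K))) : Prop :=
  C ⊆ grassmannian K n k ∧ C.ncard = M ∧
    IsLeast {e : ℕ | ∃ X ∈ C, ∃ Y ∈ C, X ≠ Y ∧ injectionDist X Y = e} d

/-- The positions of the ones of a binary vector. -/
abbrev Ones {n : ℕ} (v : Fin n → Bool) : Type := {i : Fin n // v i = true}

/-- The positions of the zeros of a binary vector. -/
abbrev Zeros {n : ℕ} (v : Fin n → Bool) : Type := {j : Fin n // v j = false}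

/-- `E` is a matrix in reduced row echelon form without zero rows, whose pivots are in the columns
in which `v` has a one. Each row is labelled by the position of its pivot, and the rows are
ordered by these labels. -/
structure IsRREF {K : Type*} [Field K] {n : ℕ} (v : Fin n → Bool)
    (E : Matrix (Ones v) (Fin n) K) : Prop where
  pivot_eq_one : ∀ i : Ones v, E i i.1 = 1
  left_eq_zero : ∀ (i : Ones v) (j : Fin n), j < i.1 → E i j = 0
  pivot_column : ∀ i i' : Ones v, i' ≠ i → E i i'.1 = 0

/-- `E = RE(X)`, and hence `v = v(X)` is the identifying vector of `X`: `E` is in reduced row echelon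
form with pivots at the ones of `v`, and its rows span (so are a basis of) `X`. -/
def IsREOf {K : Type*} [Field K] {n : ℕ} (v : Fin n → Bool)
    (E : Matrix (Ones v) (Fin n) K) (X : Submodule K (Fin n → K)) : Prop :=
  IsRREF v E ∧ Submodule.span K (Set.range fun i : Ones v => E i) = X

/-- The Ferrers tableaux form: the pivot columns are removed. The rows are labelled by the ones
of `v`, the remaining columns by the zeros of `v`. The entries to the left of the leading coefficient
of a row are kept as zeros, outside of the Ferrers diagram. -/
def tableau {K : Type*} {n : ℕ} (v : Fin n → Bool) (E : Matrix (Ones v) (Fin n) K) :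
    Matrix (Ones v) (Zeros v) K :=
  fun i j => E i j.1

/-- The Ferrers diagram of the identifying vector `v`, with rows labelled by the ones and columns
by the zeros of `v`: there is a dot in row `i` and column `j` if the non-pivot column `j` is to the
right of the pivot of row `i`. All rows are right-aligned. -/
def ferrersDiagram {n : ℕ} (v : Fin n → Bool) : Finset (Ones v × Zeros v) :=
  Finset.univ.filter fun p => p.1.1 < p.2.1

/-- The number `w_i` of dots of the Ferrers diagram of `v` that are neither in the first `i` rows nor
in the rightmost `d - 1 - i` columns. -/
def dotsOutside {n : ℕ} (v : Fin n → Bool) (d i : ℕ) : ℕ :=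
  ((ferrersDiagram v).filter fun p =>
    i ≤ (Finset.univ.filter fun a : Ones v => a.1 < p.1.1).card ∧
    d - 1 - i ≤ (Finset.univ.filter fun b : Zeros v => p.2.1 < b.1).card).card

/-- `C` is an `[F, ρ, d]` Ferrers diagram rank-metric code for the Ferrers diagram `F` of `v`. -/
def IsFDRM {K : Type*} [Field K] {n : ℕ} (v : Fin n → Bool) (ρ d : ℕ)
    (C : Submodule K (Matrix (Ones v) (Zeros v) K)) : Prop :=
  (∀ A ∈ C, ∀ i j, (i, j) ∉ ferrersDiagram v → A i j = 0) ∧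
    Module.finrank K C = ρ ∧ ∀ A ∈ C, ∀ B ∈ C, A ≠ B → d ≤ (A - B).rank

/-- An FDMRD code: an `[F, ρ, d]` Ferrers diagram rank-metric code with
`ρ = min {w_i | 0 ≤ i ≤ d - 1}`. -/
def IsFDMRD {K : Type*} [Field K] {n : ℕ} (v : Fin n → Bool) (d : ℕ)
    (C : Submodule K (Matrix (Ones v) (Zeros v) K)) : Prop :=
  ∃ ρ : ℕ, IsFDRM v ρ d C ∧ IsLeast {w : ℕ | ∃ i : ℕ, i < d ∧ dotsOutside v d i = w} ρ

/-- The lifted code: all `k`-dimensional subspaces `X` with identifying vector `v` whose Ferrers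
tableaux form is (filled by) a codeword of `C`. -/
def liftedCode {K : Type*} [Field K] {n : ℕ} (k : ℕ) (v : Fin n → Bool)
    (C : Submodule K (Matrix (Ones v) (Zeros v) K)) : Set (Submodule K (Fin n → K)) :=
  {X | X ∈ grassmannian K n k ∧
    ∃ E : Matrix (Ones v) (Fin n) K, IsREOf v E X ∧ tableau v E ∈ C}

/-- The vector `(u || v)` of length `n` with prefix `u` of length `k` and suffix `v`. -/
def concat {α : Type*} {n k : ℕ} (u : Fin k → α) (v : Fin (n - k) → α) : Fin n → α :=
  fun j => if h : j.1 < k then u ⟨j.1, h⟩ else v ⟨j.1 - k, by have := j.2; omega⟩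

/-- The vectors `(110…0), (00110…0), …` of length `m`: with coordinates `j = 1, …, m`, the `i`-th
of them has a one at `j` if and only if `⌈j / 2⌉ = i`, for `1 ≤ i ≤ ⌊m / 2⌋`. -/
def matchingVectors (m : ℕ) : Set (Fin m → Bool) :=
  {v | ∃ i : ℕ, 1 ≤ i ∧ i ≤ m / 2 ∧ ∀ j : Fin m, v j = true ↔ ((j.1 + 1) + 1) / 2 = i}

/-- The vectors `(1…100), (1…10011), …` of length `k`: with coordinates `j = 1, …, k`, the `i`-th
of them has a zero at `j` if and only if `⌈(k - j + 1) / 2⌉ = i`, for `1 ≤ i ≤ ⌊k / 2⌋`. -/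
def coMatchingVectors (k : ℕ) : Set (Fin k → Bool) :=
  {u | ∃ i : ℕ, 1 ≤ i ∧ i ≤ k / 2 ∧
    ∀ j : Fin k, u j = false ↔ ((k - (j.1 + 1) + 1) + 1) / 2 = i}

/-- The identifying vectors of Construction B: `(1…1 || 0…0)`, and all `(u || v)` with `u` the
complement of an edge in the matching of `K_k` and `v` an edge in the matching of `K_{n-k}`. -/
def identifyingVectors (n k : ℕ) : Set (Fin n → Bool) :=
  {concat (fun _ : Fin k => true) (fun _ : Fin (n - k) => false)} ∪
    {x | ∃ u ∈ coMatchingVectors k, ∃ v ∈ matchingVectors (n - k), x = concat u v}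

/-- The linear map which appends `k` zeros in front of a vector of length `n - k`. -/
def prependZeros (K : Type*) [Field K] (n k : ℕ) : (Fin (n - k) → K) →ₗ[K] (Fin n → K) where
  toFun x := concat (fun _ : Fin k => 0) x
  map_add' x y := by
    funext j
    by_cases h : j.1 < k <;> simp [concat, h]
  map_smul' c x := by
    funext j
    by_cases h : j.1 < k <;> simp [concat, h]

/-- The code of Construction B, built from Ferrers diagram rank-metric codes `F v` (of which only
those for the identifying vectors of the construction are used) and from a code `D` in
`K^{n-k}`. -/
def constructionB {K : Type*} [Field K] (n k : ℕ)
    (F : (v : Fin n → Bool) → Submodule K (Matrix (Ones v) (Zeros v) K))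
    (D : Set (Submodule K (Fin (n - k) → K))) : Set (Submodule K (Fin n → K)) :=
  (⋃ v ∈ identifyingVectors n k, liftedCode k v (F v)) ∪
    (fun Y => Submodule.map (prependZeros K n k) Y) '' D

/-- `ε(i) = 1` if `i` is odd and `ε(i) = 0` if `i` is even. -/
def eps (i : ℕ) : ℕ := if Odd i then 1 else 0

end SubspaceCode

open SubspaceCode

/-!
The pivots of a subspace, that is, the leading positions of its nonzero vectors, are the ones of its
identifying vector. So the intersection of two codewords has dimension at most the number of common
ones of their identifying vectors (`finrank_inf_le_card`). Any two distinct vectors of the construction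
have at most `k - 2` common ones (`card_inter_supports_add_two_le`), and none of them has more than
two ones among the last `n - k` coordinates, which bounds the intersection with a codeword
`{0}^k × Y` by `2 ≤ k - 2`. Two codewords with the same identifying vector intersect in the left
kernel of the difference of their Ferrers tableaux forms (`finrank_inf_add_rank_le`), so there the
rank distance takes over. These bounds also show that the parts of the code are disjoint. The
distance two itself is attained by codewords from `D`.

For the cardinality, a lifted code has as many elements as the rank-metric code
(`ncard_liftedCode`). The first row of each of the Ferrers diagrams has at least `n - k - 2 ≥ k`
dots, hence the optimal dimension for distance two is the number of dots below the first row
(`isLeast_dotsOutside_two_one`), which is then counted row by row.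

A rank-metric code of that dimension exists because the first row can be filled as a function of the
others: with rows read as elements of an extension field, a single parity check with linearly
independent coefficients excludes all matrices of rank one
(`exists_submodule_two_le_rank_of_finrank_eq`).
-/

namespace SubspaceCode

/-! ### Spaces of matrices of rank at least two with prescribed support -/

/-- A matrix of rank at most one is an outer product. -/
theorem exists_eq_mul_of_rank_lt_two {K R C : Type*} [Field K] [Fintype R] [Fintype C]
    {A : Matrix R C K} (hA : A.rank < 2) : ∃ (a : R → K) (x : C → K), ∀ r c, A r c = a r * x c := by
  classical
  rw [Matrix.rank_eq_finrank_span_row] at hA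
  obtain ⟨x, hx⟩ := finrank_le_one_iff.mp (Nat.le_of_lt_succ hA)
  choose a ha using fun r => hx ⟨A r, Submodule.subset_span ⟨r, rfl⟩⟩
  refine ⟨a, x, fun r c => ?_⟩
  have := congrFun (congrArg Subtype.val (ha r)) c
  simpa using this.symm

/-- The extension of a family on the cells of the shape `F` by zero outside of `F`. -/
noncomputable def extendByZero (K : Type*) {R C : Type*} [Field K] (F : Finset (R × C)) :
    (F → K) →ₗ[K] Matrix R C K :=
  open Classical in
  { toFun f := Matrix.of fun r c => if h : (r, c) ∈ F then f ⟨(r, c), h⟩ else 0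
    map_add' f g := by ext r c; by_cases h : (r, c) ∈ F <;> simp [h]
    map_smul' a f := by ext r c; by_cases h : (r, c) ∈ F <;> simp [h] }

theorem extendByZero_of_mem {K R C : Type*} [Field K] {F : Finset (R × C)} (f : F → K) {r : R}
    {c : C} (h : (r, c) ∈ F) : extendByZero K F f r c = f ⟨(r, c), h⟩ := by
  simp [extendByZero, h]

theorem extendByZero_of_notMem {K R C : Type*} [Field K] {F : Finset (R × C)} (f : F → K) {r : R}
    {c : C} (h : (r, c) ∉ F) : extendByZero K F f r c = 0 := by
  simp [extendByZero, h]

theorem extendByZero_injective {K R C : Type*} [Field K] (F : Finset (R × C)) :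
    Function.Injective (extendByZero K F) := by
  intro f g hfg
  ext ⟨⟨r, c⟩, h⟩
  have := congrFun (congrFun hfg r) c
  rwa [extendByZero_of_mem f h, extendByZero_of_mem g h] at this

/-- Suppose that the row `r₀` of the shape `F` meets every nonempty column of `F`, and has at least
as many cells as there are rows. Identify the cells of that row with a basis of an extension field
`L`, and take elements `h r ∈ L` that are linearly independent over `K`. The matrices supported on
`F` with `∑ h r * (row r) = 0` form a linear code whose codimension is the length of the row `r₀`.
It contains no matrix of rank one: an outer product of `a` and `x` in it satisfies
`(∑ a r • h r) * x = 0` in `L`, so that `a = 0` or `x = 0`. -/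
theorem exists_submodule_two_le_rank_of_finrank_eq {K R C : Type*} [Field K] [Fintype R]
    [Fintype C] (L : Type*) [Field L] [Algebra K L] [FiniteDimensional K L] (F : Finset (R × C))
    (r₀ : R) (hF : ∀ r c, (r, c) ∈ F → (r₀, c) ∈ F)
    (hcard : Fintype.card R ≤ Nat.card {c // (r₀, c) ∈ F})
    (hL : Module.finrank K L = Nat.card {c // (r₀, c) ∈ F}) :
    ∃ 𝒞 : Submodule K (Matrix R C K), (∀ A ∈ 𝒞, ∀ r c, (r, c) ∉ F → A r c = 0) ∧
      Module.finrank K 𝒞 + Nat.card {c // (r₀, c) ∈ F} = F.card ∧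
      ∀ A ∈ 𝒞, A ≠ 0 → 2 ≤ A.rank := by
  classical
  let φ : ({c // (r₀, c) ∈ F} → K) ≃ₗ[K] L :=
    LinearEquiv.ofFinrankEq _ _ (by rw [hL, Nat.card_eq_fintype_card, Module.finrank_pi])
  obtain ⟨e⟩ : Nonempty (R ↪ Fin (Module.finrank K L)) := by
    apply Function.Embedding.nonempty_of_card_le
    rw [Fintype.card_fin]; omega
  let h : R → L := fun r => Module.finBasis K L (e r)
  have hh : LinearIndependent K h := (Module.finBasis K L).linearIndependent.comp e e.injective
  let ψ : Matrix R C K →ₗ[K] L :=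
    { toFun A := ∑ r, h r * φ fun c => A r c.1
      map_add' A B := by
        rw [← Finset.sum_add_distrib]
        refine Finset.sum_congr rfl fun r _ => ?_
        rw [← mul_add, ← map_add]; rfl
      map_smul' a A := by
        rw [Finset.smul_sum]
        refine Finset.sum_congr rfl fun r _ => ?_
        rw [RingHom.id_apply, ← mul_smul_comm, ← map_smul]; rfl }
  have hψ : ∀ A, ψ A = ∑ r, h r * φ fun c => A r c.1 := fun _ => rfl
  -- The row `r₀` alone already gives all values of `ψ`, as its cells are unrestricted.
  have hsurj : Function.Surjective (ψ ∘ₗ extendByZero K F) := by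
    intro y
    refine ⟨fun p => if hp : p.1.1 = r₀ then φ.symm ((h r₀)⁻¹ * y) ⟨p.1.2, hp ▸ p.2⟩ else 0, ?_⟩
    rw [LinearMap.comp_apply, hψ, Finset.sum_eq_single r₀]
    · have : (fun c : {c // (r₀, c) ∈ F} => extendByZero K F (fun p =>
          if hp : p.1.1 = r₀ then φ.symm ((h r₀)⁻¹ * y) ⟨p.1.2, hp ▸ p.2⟩ else 0) r₀ c.1) =
          φ.symm ((h r₀)⁻¹ * y) := by
        ext c
        rw [extendByZero_of_mem _ c.2]
        simp
      rw [this, LinearEquiv.apply_symm_apply, mul_inv_cancel_left₀ (hh.ne_zero r₀)]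
    · intro r _ hr
      have : (fun c : {c // (r₀, c) ∈ F} => extendByZero K F (fun p =>
          if hp : p.1.1 = r₀ then φ.symm ((h r₀)⁻¹ * y) ⟨p.1.2, hp ▸ p.2⟩ else 0) r c.1) = 0 := by
        ext c
        by_cases hc : (r, c.1) ∈ F
        · rw [extendByZero_of_mem _ hc]
          simp [hr]
        · rw [extendByZero_of_notMem _ hc, Pi.zero_apply]
      rw [this, map_zero, mul_zero]
    · simp
  refine ⟨(LinearMap.ker (ψ ∘ₗ extendByZero K F)).map (extendByZero K F), ?_, ?_, ?_⟩
  · rintro _ ⟨f, -, rfl⟩ r c hrc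
    exact extendByZero_of_notMem f hrc
  · rw [(Submodule.equivMapOfInjective _ (extendByZero_injective F) _).symm.finrank_eq, ← hL, add_comm]
    have := LinearMap.finrank_range_add_finrank_ker (ψ ∘ₗ extendByZero K F)
    rw [LinearMap.range_eq_top.mpr hsurj, finrank_top] at this
    rw [this]
    simp
  · rintro _ ⟨f, hf, rfl⟩ hne
    by_contra hlt
    obtain ⟨a, x, hax⟩ := exists_eq_mul_of_rank_lt_two (not_le.mp hlt)
    have hsum : (∑ r, a r • h r) * φ (fun c => x c.1) = 0 := by
      have h0 : ψ (extendByZero K F f) = 0 := hf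
      rw [hψ] at h0
      rw [← h0, Finset.sum_mul]
      refine Finset.sum_congr rfl fun r _ => ?_
      rw [smul_mul_assoc, ← mul_smul_comm, ← map_smul]
      congr 2
      ext c
      rw [hax, Pi.smul_apply, smul_eq_mul]
    apply hne
    ext r c
    rw [Matrix.zero_apply]
    by_cases hrc : (r, c) ∈ F
    · rw [hax]
      rcases mul_eq_zero.mp hsum with h1 | h1
      · rw [Fintype.linearIndependent_iff.mp hh a h1 r, zero_mul]
      · rw [LinearEquiv.map_eq_zero_iff] at h1
        have := congrFun h1 ⟨c, hF r c hrc⟩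
        rw [show x c = 0 from this, mul_zero]
    · exact extendByZero_of_notMem f hrc

/-- Over a finite field, extension fields of every degree exist, so the previous construction always
applies. -/
theorem exists_submodule_two_le_rank {K R C : Type*} [Field K] [Finite K] [Fintype R] [Fintype C]
    (F : Finset (R × C)) (r₀ : R) (hF : ∀ r c, (r, c) ∈ F → (r₀, c) ∈ F)
    (hcard : Fintype.card R ≤ Nat.card {c // (r₀, c) ∈ F}) :
    ∃ 𝒞 : Submodule K (Matrix R C K), (∀ A ∈ 𝒞, ∀ r c, (r, c) ∉ F → A r c = 0) ∧
      Module.finrank K 𝒞 + Nat.card {c // (r₀, c) ∈ F} = F.card ∧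
      ∀ A ∈ 𝒞, A ≠ 0 → 2 ≤ A.rank := by
  have : NeZero (Nat.card {c // (r₀, c) ∈ F}) :=
    ⟨((Fintype.card_pos_iff.mpr ⟨r₀⟩).trans_le hcard).ne'⟩
  obtain ⟨p, hp⟩ := CharP.exists K
  have : Fact p.Prime := ⟨CharP.char_is_prime K p⟩
  exact exists_submodule_two_le_rank_of_finrank_eq
    (FiniteField.Extension K p (Nat.card {c // (r₀, c) ∈ F})) F r₀ hF hcard
    (FiniteField.finrank_extension K p _)


/-! ### Subspaces with a given identifying vector -/

section Subspaces

variable {K : Type*} [Field K] {n : ℕ}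

/-- The coordinates at the pivots are the coefficients with respect to the rows of the reduced row
echelon form. -/
theorem IsREOf.eq_sum {v : Fin n → Bool} {E : Matrix (Ones v) (Fin n) K}
    {X : Submodule K (Fin n → K)} (h : IsREOf v E X) {x : Fin n → K} (hx : x ∈ X) :
    x = ∑ i : Ones v, x i.1 • E i := by
  rw [← h.2, Submodule.mem_span_range_iff_exists_fun] at hx
  obtain ⟨c, rfl⟩ := hx
  refine Finset.sum_congr rfl fun i _ => ?_
  congr 1
  rw [Finset.sum_apply, Finset.sum_eq_single i]
  · simp [h.1.pivot_eq_one]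
  · intro j _ hj
    simp [h.1.pivot_column j i hj.symm]
  · simp

theorem IsREOf.row_mem {v : Fin n → Bool} {E : Matrix (Ones v) (Fin n) K}
    {X : Submodule K (Fin n → K)} (h : IsREOf v E X) (i : Ones v) : E i ∈ X :=
  h.2 ▸ Submodule.subset_span ⟨i, rfl⟩

/-- The first nonzero coordinate of a vector of `X` is at a one of the identifying vector. -/
theorem IsREOf.exists_leading {v : Fin n → Bool} {E : Matrix (Ones v) (Fin n) K}
    {X : Submodule K (Fin n → K)} (h : IsREOf v E X) {x : Fin n → K} (hx : x ∈ X) {i : Fin n}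
    (hi : x i ≠ 0) (hlt : ∀ j < i, x j = 0) : v i = true := by
  by_contra hv
  apply hi
  rw [h.eq_sum hx, Finset.sum_apply]
  refine Finset.sum_eq_zero fun r _ => ?_
  rcases lt_trichotomy r.1 i with hr | hr | hr
  · simp [hlt _ hr]
  · exact absurd (hr ▸ r.2) hv
  · simp [h.1.left_eq_zero r i hr]

theorem exists_first_ne_zero {x : Fin n → K} (hx : x ≠ 0) :
    ∃ i, x i ≠ 0 ∧ ∀ j < i, x j = 0 := by
  obtain ⟨i, hi, hmin⟩ := exists_minimal_of_wellFoundedLT (fun i => x i ≠ 0)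
    (Function.ne_iff.mp hx)
  exact ⟨i, hi, fun j hj => by_contra fun h => (hj.not_ge (hmin h hj.le)).elim⟩

/-- A subspace whose nonzero vectors all have a nonzero coordinate in `S` is determined by the
coordinates in `S`. -/
theorem finrank_le_card_of_forall_exists {W : Submodule K (Fin n → K)} (S : Finset (Fin n))
    (hW : ∀ x ∈ W, x ≠ 0 → ∃ i ∈ S, x i ≠ 0) : Module.finrank K W ≤ S.card := by
  let f : W →ₗ[K] (S → K) := (LinearMap.funLeft K K Subtype.val) ∘ₗ W.subtype
  have hf : Function.Injective f := by
    rw [injective_iff_map_eq_zero]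
    rintro ⟨x, hx⟩ h0
    by_contra hne
    obtain ⟨i, hi, hxi⟩ := hW x hx fun h => hne (by simp [h])
    exact hxi (congrFun h0 ⟨i, hi⟩)
  simpa using LinearMap.finrank_le_finrank_of_injective hf

/-- The leading positions of the vectors of `X ⊓ Y` are common ones of the two identifying
vectors. -/
theorem finrank_inf_le_card {v v' : Fin n → Bool} {E : Matrix (Ones v) (Fin n) K}
    {E' : Matrix (Ones v') (Fin n) K} {X Y : Submodule K (Fin n → K)} (hX : IsREOf v E X)
    (hY : IsREOf v' E' Y) :
    Module.finrank K (X ⊓ Y : Submodule K (Fin n → K)) ≤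
      (Finset.univ.filter fun i => v i = true ∧ v' i = true).card := by
  refine finrank_le_card_of_forall_exists _ fun x hx hne => ?_
  obtain ⟨i, hi, hlt⟩ := exists_first_ne_zero hne
  exact ⟨i, by simp [hX.exists_leading hx.1 hi hlt, hY.exists_leading hx.2 hi hlt], hi⟩

/-- Two subspaces with the same identifying vector intersect in the left kernel of the difference
of their Ferrers tableaux forms. -/
theorem finrank_inf_add_rank_le {v : Fin n → Bool} {E E' : Matrix (Ones v) (Fin n) K}
    {X Y : Submodule K (Fin n → K)} (hX : IsREOf v E X) (hY : IsREOf v E' Y) :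
    Module.finrank K (X ⊓ Y : Submodule K (Fin n → K)) + (tableau v E - tableau v E').rank ≤
      Fintype.card (Ones v) := by
  set B := tableau v E - tableau v E' with hB
  have hker : ∀ x ∈ X ⊓ Y, Matrix.vecMul (fun i : Ones v => x i.1) B = 0 := by
    intro x hx
    ext j
    have h1 := congrFun (hX.eq_sum hx.1) j.1
    have h2 := congrFun (hY.eq_sum hx.2) j.1
    rw [Finset.sum_apply] at h1 h2
    rw [hB, Matrix.vecMul_sub, Pi.sub_apply, Pi.zero_apply, sub_eq_zero]
    exact h1.symm.trans h2
  let f : (X ⊓ Y : Submodule K (Fin n → K)) →ₗ[K] LinearMap.ker B.vecMulLinear :=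
    ((LinearMap.funLeft K K (Subtype.val : Ones v → Fin n)) ∘ₗ Submodule.subtype _).codRestrict _
      fun x => by
        rw [LinearMap.mem_ker, Matrix.vecMulLinear_apply]
        exact hker x.1 x.2
  have hf : Function.Injective f := by
    rw [injective_iff_map_eq_zero]
    rintro ⟨x, hx⟩ h0
    have h0' : ∀ i : Ones v, x i.1 = 0 := fun i => congrFun (congrArg Subtype.val h0) i
    refine Subtype.ext ((hX.eq_sum hx.1).trans ?_)
    exact Finset.sum_eq_zero fun i _ => by rw [h0', zero_smul]
  have h1 := LinearMap.finrank_le_finrank_of_injective hf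
  have h2 := LinearMap.finrank_range_add_finrank_ker B.vecMulLinear
  rw [range_vecMulLinear, ← Matrix.rank_eq_finrank_span_row,
    Module.finrank_fintype_fun_eq_card] at h2
  omega

/-- The matrix in reduced row echelon form with pivots at the ones of `v` and with the columns of
`A` at the zeros of `v`. -/
def echelonMatrix (v : Fin n → Bool) (A : Matrix (Ones v) (Zeros v) K) :
    Matrix (Ones v) (Fin n) K :=
  fun i j => if h : v j = false then A i ⟨j, h⟩ else if i.1 = j then 1 else 0

theorem tableau_echelonMatrix (v : Fin n → Bool) (A : Matrix (Ones v) (Zeros v) K) :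
    tableau v (echelonMatrix v A) = A := by
  ext i j
  simp [tableau, echelonMatrix, j.2]

theorem isRREF_echelonMatrix {v : Fin n → Bool} {A : Matrix (Ones v) (Zeros v) K}
    (hA : ∀ i j, (i, j) ∉ ferrersDiagram v → A i j = 0) : IsRREF v (echelonMatrix v A) where
  pivot_eq_one i := by simp [echelonMatrix, i.2]
  left_eq_zero i j hj := by
    by_cases h : v j = false
    · simp only [echelonMatrix, h, dite_true]
      exact hA _ _ (by simp [ferrersDiagram, hj.le])
    · simp [echelonMatrix, h, hj.ne']
  pivot_column i i' h := by
    have : i.1 ≠ i'.1 := fun h' => h (Subtype.ext h'.symm)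
    simp [echelonMatrix, i'.2, this]

/-- The reduced row echelon form is determined by the Ferrers tableaux form. -/
theorem IsRREF.eq_echelonMatrix {v : Fin n → Bool} {E : Matrix (Ones v) (Fin n) K}
    (h : IsRREF v E) : E = echelonMatrix v (tableau v E) := by
  ext i j
  by_cases hj : v j = false
  · simp [echelonMatrix, hj, tableau]
  · rw [Bool.not_eq_false] at hj
    by_cases hij : i.1 = j
    · subst hij
      simp [echelonMatrix, h.pivot_eq_one, i.2]
    · simp only [echelonMatrix, hj, hij]
      exact h.pivot_column i ⟨j, hj⟩ fun h' => hij (congrArg Subtype.val h').symm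

/-- The reduced row echelon form is determined by the subspace. -/
theorem IsREOf.unique {v : Fin n → Bool} {E E' : Matrix (Ones v) (Fin n) K}
    {X : Submodule K (Fin n → K)} (h : IsREOf v E X) (h' : IsREOf v E' X) : E = E' := by
  funext i
  rw [h'.eq_sum (h.row_mem i), Finset.sum_eq_single i]
  · rw [h.1.pivot_eq_one, one_smul]
  · intro j _ hj
    rw [h.1.pivot_column i j hj, zero_smul]
  · simp

theorem IsRREF.linearIndependent {v : Fin n → Bool} {E : Matrix (Ones v) (Fin n) K}
    (h : IsRREF v E) : LinearIndependent K fun i => E i := by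
  rw [Fintype.linearIndependent_iff]
  intro c hc i
  have := congrFun hc i.1
  rw [Finset.sum_apply, Finset.sum_eq_single i] at this
  · simpa [h.pivot_eq_one] using this
  · intro j _ hj
    simp [h.pivot_column j i hj.symm]
  · simp

theorem IsREOf.finrank_eq {v : Fin n → Bool} {E : Matrix (Ones v) (Fin n) K}
    {X : Submodule K (Fin n → K)} (h : IsREOf v E X) :
    Module.finrank K X = Fintype.card (Ones v) := by
  rw [← h.2, finrank_span_eq_card h.1.linearIndependent]

/-- The codewords of a lifted Ferrers diagram rank-metric code are in bijection with the matrices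
of that code. -/
theorem ncard_liftedCode [Finite K] {v : Fin n → Bool} {k ρ d : ℕ}
    {𝒞 : Submodule K (Matrix (Ones v) (Zeros v) K)} (h𝒞 : IsFDRM v ρ d 𝒞)
    (hv : Fintype.card (Ones v) = k) : (liftedCode k v 𝒞).ncard = Nat.card K ^ ρ := by
  let g : Matrix (Ones v) (Zeros v) K → Submodule K (Fin n → K) := fun A =>
    Submodule.span K (Set.range fun i : Ones v => echelonMatrix v A i)
  have hg : ∀ A ∈ 𝒞, IsREOf v (echelonMatrix v A) (g A) := fun A hA =>
    ⟨isRREF_echelonMatrix (h𝒞.1 A hA), rfl⟩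
  have himage : liftedCode k v 𝒞 = g '' 𝒞 := by
    ext X
    constructor
    · rintro ⟨-, E, hE, hEC⟩
      exact ⟨_, hEC, by simp only [g, ← hE.1.eq_echelonMatrix]; exact hE.2⟩
    · rintro ⟨A, hA, rfl⟩
      refine ⟨(hg A hA).finrank_eq.trans hv, _, hg A hA, ?_⟩
      rwa [tableau_echelonMatrix]
  rw [himage, Set.InjOn.ncard_image, ← h𝒞.2.1]
  · exact Module.natCard_eq_pow_finrank (K := K) (V := 𝒞)
  · intro A hA B hB hAB
    have := (hg A hA).unique (hAB ▸ hg B hB)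
    rw [← tableau_echelonMatrix v A, this, tableau_echelonMatrix]

/-! ### Subspaces of the last coordinates -/

theorem prependZeros_apply_of_lt {k : ℕ} (x : Fin (n - k) → K) {j : Fin n} (hj : j.1 < k) :
    prependZeros K n k x j = 0 := by
  simp [prependZeros, concat, hj]

theorem prependZeros_injective (K : Type*) [Field K] (n k : ℕ) :
    Function.Injective (prependZeros K n k) := by
  intro x y hxy
  ext j
  have := congrFun hxy ⟨j.1 + k, by omega⟩
  simpa [prependZeros, concat] using this

theorem finrank_map_prependZeros {k : ℕ} (Y : Submodule K (Fin (n - k) → K)) :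
    Module.finrank K (Y.map (prependZeros K n k)) = Module.finrank K Y :=
  (Submodule.equivMapOfInjective _ (prependZeros_injective K n k) Y).symm.finrank_eq

/-- Vectors with zeros in the first `k` coordinates have their leading position behind them. -/
theorem finrank_inf_map_prependZeros_le {k : ℕ} {v : Fin n → Bool} {E : Matrix (Ones v) (Fin n) K}
    {X : Submodule K (Fin n → K)} (hX : IsREOf v E X) (Y : Submodule K (Fin (n - k) → K)) :
    Module.finrank K (X ⊓ Y.map (prependZeros K n k) : Submodule K (Fin n → K)) ≤
      (Finset.univ.filter fun i => v i = true ∧ k ≤ i.1).card := by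
  refine finrank_le_card_of_forall_exists _ fun x hx hne => ?_
  obtain ⟨i, hi, hlt⟩ := exists_first_ne_zero hne
  refine ⟨i, ?_, hi⟩
  simp only [Finset.mem_filter, Finset.mem_univ, true_and]
  refine ⟨hX.exists_leading hx.1 hi hlt, ?_⟩
  by_contra hik
  obtain ⟨y, -, rfl⟩ := hx.2
  exact hi (prependZeros_apply_of_lt y (not_le.mp hik))

theorem injectionDist_map_prependZeros {k : ℕ} (X Y : Submodule K (Fin (n - k) → K)) :
    injectionDist (X.map (prependZeros K n k)) (Y.map (prependZeros K n k)) =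
      injectionDist X Y := by
  have hinj := prependZeros_injective K n k
  rw [injectionDist, injectionDist, ← Submodule.map_inf _ hinj, finrank_map_prependZeros,
    finrank_map_prependZeros, finrank_map_prependZeros]

end Subspaces


/-! ### The optimal dimension for distance two -/

section Dots

variable {n : ℕ} {v : Fin n → Bool} {r₀ : Ones v}

theorem mem_ferrersDiagram {p : Ones v × Zeros v} : p ∈ ferrersDiagram v ↔ p.1.1 < p.2.1 := by
  simp [ferrersDiagram]

theorem dotsOutside_two_one (hr₀ : ∀ r : Ones v, r₀ ≤ r) :
    dotsOutside v 2 1 = ((ferrersDiagram v).filter fun p => p.1 ≠ r₀).card := by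
  unfold dotsOutside
  congr 1
  refine Finset.filter_congr fun p _ => ?_
  simp only [Nat.sub_self, Nat.zero_le, and_true, Nat.one_le_iff_ne_zero, ne_eq,
    Finset.card_eq_zero, Finset.filter_eq_empty_iff, Finset.mem_univ, true_implies]
  refine not_congr ⟨fun h => le_antisymm (not_lt.mp (@h r₀)) (hr₀ _), ?_⟩
  rintro h a ha
  exact ha.not_ge (h ▸ hr₀ a)

theorem dotsOutside_two_one_add (hr₀ : ∀ r : Ones v, r₀ ≤ r) :
    dotsOutside v 2 1 + Nat.card {c // (r₀, c) ∈ ferrersDiagram v} = (ferrersDiagram v).card := by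
  classical
  rw [dotsOutside_two_one hr₀, ← Finset.card_filter_add_card_filter_not (s := ferrersDiagram v)
    (fun p => p.1 ≠ r₀)]
  congr 1
  rw [Nat.card_eq_fintype_card, Fintype.card_subtype]
  refine Finset.card_bij (fun c _ => (r₀, c)) ?_ ?_ ?_
  · intro c hc
    simpa using hc
  · intro c _ c' _ h
    exact congrArg Prod.snd h
  · rintro ⟨r, c⟩ hrc
    simp only [ne_eq, not_not, Finset.mem_filter] at hrc
    obtain ⟨hrc, rfl⟩ := hrc
    exact ⟨c, by simpa using hrc, rfl⟩

/-- Removing the rightmost column removes at most one dot from each row. -/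
theorem card_ferrersDiagram_le (v : Fin n → Bool) :
    (ferrersDiagram v).card ≤ dotsOutside v 2 0 + Fintype.card (Ones v) := by
  classical
  rw [dotsOutside, ← Finset.card_filter_add_card_filter_not (s := ferrersDiagram v)
    (fun p => 0 ≤ (Finset.univ.filter fun a : Ones v => a.1 < p.1.1).card ∧
      2 - 1 - 0 ≤ (Finset.univ.filter fun b : Zeros v => p.2.1 < b.1).card)]
  gcongr
  refine Finset.card_le_card_of_injOn Prod.fst (fun _ _ => Finset.mem_coe.mpr (Finset.mem_univ _)) ?_
  -- Two dots of the same row with no zero of `v` to their right are equal.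
  have key : ∀ p ∈ (ferrersDiagram v).filter fun p =>
      ¬(0 ≤ (Finset.univ.filter fun a : Ones v => a.1 < p.1.1).card ∧
        2 - 1 - 0 ≤ (Finset.univ.filter fun b : Zeros v => p.2.1 < b.1).card),
      ∀ b : Zeros v, b ≤ p.2 := by
    intro p hp b
    have := (Finset.mem_filter.mp hp).2
    simp only [Nat.zero_le, true_and, not_le, Nat.sub_zero, Nat.add_one_sub_one, Nat.lt_one_iff,
      Finset.card_eq_zero, Finset.filter_eq_empty_iff, Finset.mem_univ, true_implies] at this
    exact not_lt.mp (@this b)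
  intro p hp p' hp' h
  exact Prod.ext h (le_antisymm (key p' hp' _) (key p hp _))

/-- If the first row has at least as many dots as there are rows, then it is the first row, and not
the last column, whose removal gives the bound on the dimension. -/
theorem isLeast_dotsOutside_two_one (hr₀ : ∀ r : Ones v, r₀ ≤ r)
    (hcard : Fintype.card (Ones v) ≤ Nat.card {c // (r₀, c) ∈ ferrersDiagram v}) :
    IsLeast {w : ℕ | ∃ i : ℕ, i < 2 ∧ dotsOutside v 2 i = w} (dotsOutside v 2 1) := by
  refine ⟨⟨1, by norm_num, rfl⟩, ?_⟩
  rintro _ ⟨i, hi, rfl⟩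
  have h1 := dotsOutside_two_one_add hr₀
  have h2 := card_ferrersDiagram_le v
  interval_cases i <;> omega

theorem exists_isFDMRD_two (K : Type*) [Field K] [Finite K] (hr₀ : ∀ r : Ones v, r₀ ≤ r)
    (hcard : Fintype.card (Ones v) ≤ Nat.card {c // (r₀, c) ∈ ferrersDiagram v}) :
    ∃ 𝒞 : Submodule K (Matrix (Ones v) (Zeros v) K), IsFDMRD v 2 𝒞 := by
  obtain ⟨𝒞, hsupp, hdim, hrank⟩ := exists_submodule_two_le_rank (K := K) (ferrersDiagram v) r₀
    (fun r c h => mem_ferrersDiagram.mpr (lt_of_le_of_lt (hr₀ r) (mem_ferrersDiagram.mp h))) hcard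
  refine ⟨𝒞, _, ⟨hsupp, rfl, fun A hA B hB hAB =>
    hrank _ (𝒞.sub_mem hA hB) (sub_ne_zero.mpr hAB)⟩, ?_⟩
  have := dotsOutside_two_one_add hr₀
  rw [show Module.finrank K 𝒞 = dotsOutside v 2 1 by omega]
  exact isLeast_dotsOutside_two_one hr₀ hcard

theorem IsFDMRD.isFDRM_two {K : Type*} [Field K]
    {𝒞 : Submodule K (Matrix (Ones v) (Zeros v) K)} (h𝒞 : IsFDMRD v 2 𝒞)
    (hr₀ : ∀ r : Ones v, r₀ ≤ r)
    (hcard : Fintype.card (Ones v) ≤ Nat.card {c // (r₀, c) ∈ ferrersDiagram v}) :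
    IsFDRM v (dotsOutside v 2 1) 2 𝒞 := by
  obtain ⟨ρ, h, hρ⟩ := h𝒞
  rwa [hρ.unique (isLeast_dotsOutside_two_one hr₀ hcard)] at h

end Dots

/-! ### Binary vectors given by their support -/

/-- The binary vector of length `n` whose ones are at the positions in `S`. -/
def indicatorVec (n : ℕ) (S : Finset ℕ) : Fin n → Bool := fun j => decide (j.1 ∈ S)

section IndicatorVec

variable {n : ℕ} {S S' : Finset ℕ}

theorem indicatorVec_eq_true {j : Fin n} : indicatorVec n S j = true ↔ j.1 ∈ S := by
  simp [indicatorVec]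

theorem indicatorVec_eq_false {j : Fin n} : indicatorVec n S j = false ↔ j.1 ∉ S := by
  simp [indicatorVec]

theorem card_filter_fin (hS : S ⊆ Finset.range n) :
    (Finset.univ.filter fun j : Fin n => j.1 ∈ S).card = S.card := by
  refine Finset.card_bij (fun j _ => j.1) (by simp) (fun _ _ _ _ h => Fin.ext h) fun a ha => ?_
  exact ⟨⟨a, Finset.mem_range.mp (hS ha)⟩, by simpa using ha, rfl⟩

theorem card_ones_indicatorVec (hS : S ⊆ Finset.range n) :
    Fintype.card (Ones (indicatorVec n S)) = S.card := by
  rw [Fintype.card_subtype, ← card_filter_fin hS]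
  simp [indicatorVec]

theorem card_row_indicatorVec (r : Ones (indicatorVec n S)) :
    Nat.card {c // (r, c) ∈ ferrersDiagram (indicatorVec n S)} =
      ((Finset.range n \ S).filter (r.1.1 < ·)).card := by
  classical
  rw [Nat.card_eq_fintype_card, Fintype.card_subtype]
  refine Finset.card_bij (fun c _ => c.1.1) ?_ (fun _ _ _ _ h => Subtype.ext (Fin.ext h)) ?_
  · rintro ⟨c, hc⟩ h
    rw [indicatorVec_eq_false] at hc
    simpa [mem_ferrersDiagram, hc] using h
  · intro a ha
    simp only [Finset.mem_filter, Finset.mem_sdiff, Finset.mem_range] at ha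
    exact ⟨⟨⟨a, ha.1.1⟩, indicatorVec_eq_false.mpr ha.1.2⟩,
      Finset.mem_filter.mpr ⟨Finset.mem_univ _, mem_ferrersDiagram.mpr (Fin.lt_def.mpr ha.2)⟩, rfl⟩

theorem dotsOutside_two_one_indicatorVec (hS : S ⊆ Finset.range n)
    {r₀ : Ones (indicatorVec n S)} (hr₀ : ∀ r, r₀ ≤ r) :
    dotsOutside (indicatorVec n S) 2 1 =
      ∑ a ∈ S.erase r₀.1.1, ((Finset.range n \ S).filter (a < ·)).card := by
  classical
  rw [dotsOutside_two_one hr₀, ← Finset.card_sigma]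
  refine Finset.card_bij (fun p _ => ⟨p.1.1.1, p.2.1.1⟩) ?_ ?_ ?_
  · rintro ⟨⟨r, hr⟩, ⟨c, hc⟩⟩ h
    rw [Finset.mem_filter, mem_ferrersDiagram] at h
    rw [indicatorVec_eq_true] at hr
    rw [indicatorVec_eq_false] at hc
    have hne : r.1 ≠ r₀.1.1 := fun h' => h.2 (Subtype.ext (Fin.ext h'))
    simpa [hr, hc, hne] using h.1
  · rintro ⟨r, c⟩ - ⟨r', c'⟩ - h
    simp only [Sigma.mk.injEq, heq_eq_eq] at h
    exact Prod.ext (Subtype.ext (Fin.ext h.1)) (Subtype.ext (Fin.ext h.2))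
  · rintro ⟨a, b⟩ hab
    simp only [Finset.mem_sigma, Finset.mem_erase, Finset.mem_filter, Finset.mem_sdiff,
      Finset.mem_range] at hab
    refine ⟨(⟨⟨a, Finset.mem_range.mp (hS hab.1.2)⟩, indicatorVec_eq_true.mpr hab.1.2⟩,
      ⟨⟨b, hab.2.1.1⟩, indicatorVec_eq_false.mpr hab.2.1.2⟩), ?_, rfl⟩
    rw [Finset.mem_filter, mem_ferrersDiagram]
    refine ⟨Fin.lt_def.mpr hab.2.2, fun h => hab.1.1 ?_⟩
    exact congrArg (fun r => r.1.1) h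

theorem card_inter_add_two_le {a b : ℕ} (hab : a ≠ b) (ha : a ∈ S) (hb : b ∈ S) (ha' : a ∉ S')
    (hb' : b ∉ S') : (S ∩ S').card + 2 ≤ S.card := by
  rw [← Finset.card_inter_add_card_sdiff S S', ← Finset.card_pair hab]
  gcongr
  intro x hx
  rcases Finset.mem_insert.mp hx with rfl | hx
  · exact Finset.mem_sdiff.mpr ⟨ha, ha'⟩
  · obtain rfl := Finset.mem_singleton.mp hx
    exact Finset.mem_sdiff.mpr ⟨hb, hb'⟩

end IndicatorVec


/-! ### The identifying vectors of the construction -/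

/-- The support of the vector `(u || v)` with the two zeros of `u` at the positions `a`, `a + 1` and
the two ones of `v` at the positions `b`, `b + 1` of the whole vector. -/
def gapSupport (a k b : ℕ) : Finset ℕ :=
  Finset.range a ∪ Finset.Ico (a + 2) k ∪ Finset.Ico b (b + 2)

theorem mem_gapSupport {a k b x : ℕ} :
    x ∈ gapSupport a k b ↔ x < a ∨ a + 2 ≤ x ∧ x < k ∨ b ≤ x ∧ x < b + 2 := by
  simp [gapSupport]

/-- The supports of the identifying vectors. The pairs of zeros and of ones are numbered from the
middle outwards, starting with `0`. -/
def supports (n k : ℕ) : Finset (Finset ℕ) :=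
  insert (Finset.range k) ((Finset.range (k / 2) ×ˢ Finset.range ((n - k) / 2)).image
    fun p => gapSupport (k - 2 * p.1 - 2) k (k + 2 * p.2))

theorem mem_supports {n k : ℕ} {S : Finset ℕ} : S ∈ supports n k ↔ S = Finset.range k ∨
    ∃ i l, i < k / 2 ∧ l < (n - k) / 2 ∧ S = gapSupport (k - 2 * i - 2) k (k + 2 * l) := by
  simp only [supports, Finset.mem_insert, Finset.mem_image, Finset.mem_product, Finset.mem_range,
    Prod.exists, eq_comm (a := S), and_assoc]

theorem concat_eq_indicatorVec_gapSupport {n k i l : ℕ} (hi : i < k / 2)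
    {u : Fin k → Bool} {v : Fin (n - k) → Bool}
    (hu : ∀ j : Fin k, u j = false ↔ ((k - (j.1 + 1) + 1) + 1) / 2 = i + 1)
    (hv : ∀ j : Fin (n - k), v j = true ↔ ((j.1 + 1) + 1) / 2 = l + 1) :
    concat u v = indicatorVec n (gapSupport (k - 2 * i - 2) k (k + 2 * l)) := by
  funext j
  rw [Bool.eq_iff_iff, indicatorVec_eq_true, mem_gapSupport]
  by_cases h : j.1 < k
  · rw [concat, dif_pos h]
    have hj : (k - (j.1 + 1) + 1 + 1) / 2 = i + 1 ↔ k ≤ j.1 + 2 * i + 2 ∧ j.1 + 2 * i + 1 ≤ k := by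
      omega
    rw [← Bool.not_eq_false, hu, hj]
    omega
  · rw [concat, dif_neg h]
    have hj : (j.1 - k + 1 + 1) / 2 = l + 1 ↔ k + 2 * l ≤ j.1 ∧ j.1 < k + 2 * l + 2 := by
      omega
    rw [hv, hj]
    omega

theorem identifyingVectors_eq_image (n k : ℕ) :
    identifyingVectors n k = indicatorVec n '' supports n k := by
  have htop : (concat (fun _ : Fin k => true) fun _ : Fin (n - k) => false) =
      indicatorVec n (Finset.range k) := by
    funext j
    by_cases h : j.1 < k <;> simp [concat, indicatorVec, h]
  ext x
  simp only [identifyingVectors, htop, Set.mem_union, Set.mem_singleton_iff, Set.mem_ofPred_eq,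
    Set.mem_image, Finset.mem_coe, mem_supports]
  constructor
  · rintro (rfl | ⟨u, ⟨i, hi1, hi, hu⟩, v, ⟨l, hl1, hl, hv⟩, rfl⟩)
    · exact ⟨_, Or.inl rfl, rfl⟩
    · obtain ⟨i, rfl⟩ := Nat.exists_eq_add_of_le' hi1
      obtain ⟨l, rfl⟩ := Nat.exists_eq_add_of_le' hl1
      exact ⟨_, Or.inr ⟨i, l, hi, hl, rfl⟩, (concat_eq_indicatorVec_gapSupport hi hu hv).symm⟩
  · rintro ⟨S, rfl | ⟨i, l, hi, hl, rfl⟩, rfl⟩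
    · exact Or.inl rfl
    · have hu : ∀ j : Fin k, (!decide (((k - (j.1 + 1) + 1) + 1) / 2 = i + 1)) = false ↔
          ((k - (j.1 + 1) + 1) + 1) / 2 = i + 1 := by simp
      have hv : ∀ j : Fin (n - k), decide (((j.1 + 1) + 1) / 2 = l + 1) = true ↔
          ((j.1 + 1) + 1) / 2 = l + 1 := by simp
      exact Or.inr ⟨_, ⟨i + 1, by omega, hi, hu⟩, _, ⟨l + 1, by omega, hl, hv⟩,
        (concat_eq_indicatorVec_gapSupport hi hu hv).symm⟩

theorem subset_range_of_mem_supports {n k : ℕ} (hkn : k ≤ n) {S : Finset ℕ}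
    (hS : S ∈ supports n k) : S ⊆ Finset.range n := by
  rcases mem_supports.mp hS with rfl | ⟨i, l, hi, hl, rfl⟩
  · exact Finset.range_mono hkn
  · intro x hx
    rw [mem_gapSupport] at hx
    rw [Finset.mem_range]
    omega

theorem sum_gapSupport {M : Type*} [AddCommMonoid M] {a c d k b : ℕ} (had : a ≤ d) (hdk : d ≤ k)
    (hkb : k ≤ b) (f : ℕ → M) : ∑ x ∈ Finset.Ico c a ∪ Finset.Ico d k ∪ Finset.Ico b (b + 2), f x =
      ∑ x ∈ Finset.Ico c a, f x + ∑ x ∈ Finset.Ico d k, f x + ∑ x ∈ Finset.Ico b (b + 2), f x := by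
  rw [Finset.sum_union, Finset.sum_union]
  · rw [Finset.disjoint_left]
    intro x
    simp only [Finset.mem_Ico]
    omega
  · rw [Finset.disjoint_left]
    intro x
    simp only [Finset.mem_union, Finset.mem_Ico]
    omega

theorem card_of_mem_supports {n k : ℕ} {S : Finset ℕ} (hS : S ∈ supports n k) : S.card = k := by
  rcases mem_supports.mp hS with rfl | ⟨i, l, hi, hl, rfl⟩
  · simp
  · rw [gapSupport, Finset.range_eq_Ico, Finset.card_eq_sum_ones,
      sum_gapSupport (by omega) (by omega) (by omega)]
    simp only [Finset.sum_const, Nat.card_Ico, smul_eq_mul, mul_one]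
    omega

theorem gapSupport_injOn {n k : ℕ} : Set.InjOn
    (fun p : ℕ × ℕ => gapSupport (k - 2 * p.1 - 2) k (k + 2 * p.2))
    (Finset.range (k / 2) ×ˢ Finset.range ((n - k) / 2) : Finset (ℕ × ℕ)) := by
  rintro ⟨i, l⟩ hp ⟨i', l'⟩ hp' h
  simp only [Finset.coe_product, Finset.coe_range, Set.mem_prod, Set.mem_Iio] at hp hp'
  simp only at h
  have h1 : k - 2 * i - 2 ∉ gapSupport (k - 2 * i - 2) k (k + 2 * l) := by
    rw [mem_gapSupport]; omega
  have h2 : k - 2 * i - 1 ∉ gapSupport (k - 2 * i - 2) k (k + 2 * l) := by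
    rw [mem_gapSupport]; omega
  have h3 : k + 2 * l ∈ gapSupport (k - 2 * i - 2) k (k + 2 * l) := by
    rw [mem_gapSupport]; omega
  rw [h, mem_gapSupport] at h1 h2 h3
  ext <;> simp only <;> omega

theorem range_notMem_image_gapSupport {n k : ℕ} : Finset.range k ∉
    (Finset.range (k / 2) ×ˢ Finset.range ((n - k) / 2)).image
      fun p => gapSupport (k - 2 * p.1 - 2) k (k + 2 * p.2) := by
  simp only [Finset.mem_image, Finset.mem_product, Finset.mem_range, Prod.exists, not_exists,
    not_and]
  intro i l _ h
  have : k + 2 * l ∈ Finset.range k := by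
    rw [← h, mem_gapSupport]; omega
  rw [Finset.mem_range] at this
  omega

/-- Two distinct identifying vectors have Hamming distance at least four. -/
theorem card_inter_supports_add_two_le {n k : ℕ} {S S' : Finset ℕ} (hS : S ∈ supports n k)
    (hS' : S' ∈ supports n k) (hne : S ≠ S') : (S ∩ S').card + 2 ≤ k := by
  rw [← card_of_mem_supports hS]
  rcases mem_supports.mp hS with rfl | ⟨i, l, hi, hl, rfl⟩ <;>
    rcases mem_supports.mp hS' with rfl | ⟨i', l', hi', hl', rfl⟩
  · exact absurd rfl hne
  · exact card_inter_add_two_le (a := k - 2 * i' - 2) (b := k - 2 * i' - 1)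
      (by omega) (by rw [Finset.mem_range]; omega) (by rw [Finset.mem_range]; omega)
      (by rw [mem_gapSupport]; omega) (by rw [mem_gapSupport]; omega)
  · exact card_inter_add_two_le (a := k + 2 * l) (b := k + 2 * l + 1) (by omega)
      (by rw [mem_gapSupport]; omega) (by rw [mem_gapSupport]; omega) (by simp)
      (by rw [Finset.mem_range]; omega)
  · by_cases hii : i = i'
    · subst hii
      have hll : l ≠ l' := fun h => hne (by rw [h])
      exact card_inter_add_two_le (a := k + 2 * l) (b := k + 2 * l + 1) (by omega)
        (by rw [mem_gapSupport]; omega) (by rw [mem_gapSupport]; omega)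
        (by rw [mem_gapSupport]; omega) (by rw [mem_gapSupport]; omega)
    · exact card_inter_add_two_le (a := k - 2 * i' - 2) (b := k - 2 * i' - 1) (by omega)
        (by rw [mem_gapSupport]; omega) (by rw [mem_gapSupport]; omega)
        (by rw [mem_gapSupport]; omega) (by rw [mem_gapSupport]; omega)

theorem card_filter_le_two_of_mem_supports {n k : ℕ} {S : Finset ℕ} (hS : S ∈ supports n k) :
    (S.filter (k ≤ ·)).card ≤ 2 := by
  rcases mem_supports.mp hS with rfl | ⟨i, l, hi, hl, rfl⟩
  · rw [Finset.filter_eq_empty_iff.mpr fun x hx => not_le.mpr (Finset.mem_range.mp hx)]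
    simp
  · refine (Finset.card_le_card (t := Finset.Ico (k + 2 * l) (k + 2 * l + 2)) fun x hx => ?_).trans
      (by simp)
    rw [Finset.mem_filter, mem_gapSupport] at hx
    rw [Finset.mem_Ico]
    omega

/-! ### The dimensions of the rank-metric codes -/

section Dimension

variable {n a k b : ℕ}

theorem card_zeros_after_range {j : ℕ} (hj : j < k) :
    ((Finset.range n \ Finset.range k).filter (j < ·)).card = n - k := by
  rw [← Nat.card_Ico]
  congr 1
  ext x
  simp only [Finset.mem_filter, Finset.mem_sdiff, Finset.mem_range, Finset.mem_Ico]
  omega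

theorem card_zeros_after_gapSupport_of_le {j : ℕ} (hak : a + 2 ≤ k) (hkb : k ≤ b) (hbj : b ≤ j)
    (hj : j < b + 2) :
    ((Finset.range n \ gapSupport a k b).filter (j < ·)).card = n - b - 2 := by
  rw [show n - b - 2 = n - (b + 2) by omega, ← Nat.card_Ico]
  congr 1
  ext x
  simp only [Finset.mem_filter, Finset.mem_sdiff, Finset.mem_range, Finset.mem_Ico, mem_gapSupport]
  omega

theorem card_zeros_after_gapSupport_of_lt {j : ℕ} (hkb : k ≤ b) (hb : b + 2 ≤ n)
    (haj : a + 2 ≤ j) (hj : j < k) :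
    ((Finset.range n \ gapSupport a k b).filter (j < ·)).card = n - k - 2 := by
  have : (Finset.range n \ gapSupport a k b).filter (j < ·) =
      Finset.Ico k b ∪ Finset.Ico (b + 2) n := by
    ext x
    simp only [Finset.mem_filter, Finset.mem_sdiff, Finset.mem_range, Finset.mem_Ico,
      Finset.mem_union, mem_gapSupport]
    omega
  rw [this, Finset.card_union_of_disjoint, Nat.card_Ico, Nat.card_Ico]
  · omega
  · rw [Finset.disjoint_left]
    intro x
    simp only [Finset.mem_Ico]
    omega

theorem card_zeros_after_gapSupport_of_lt_left {j : ℕ} (hak : a + 2 ≤ k) (hkb : k ≤ b)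
    (hb : b + 2 ≤ n) (hj : j < a) :
    ((Finset.range n \ gapSupport a k b).filter (j < ·)).card = n - k := by
  have : (Finset.range n \ gapSupport a k b).filter (j < ·) =
      Finset.Ico a (a + 2) ∪ (Finset.Ico k b ∪ Finset.Ico (b + 2) n) := by
    ext x
    simp only [Finset.mem_filter, Finset.mem_sdiff, Finset.mem_range, Finset.mem_Ico,
      Finset.mem_union, mem_gapSupport]
    omega
  rw [this, Finset.card_union_of_disjoint, Finset.card_union_of_disjoint, Nat.card_Ico,
    Nat.card_Ico, Nat.card_Ico]
  · omega
  · rw [Finset.disjoint_left]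
    intro x
    simp only [Finset.mem_Ico]
    omega
  · rw [Finset.disjoint_left]
    intro x
    simp only [Finset.mem_union, Finset.mem_Ico]
    omega

/-- The number of dots in the rows with pivots in `[c, a)`, `[d, k)` and `{b, b + 1}`. For suitable `c`
and `d` these are all rows but the first one. -/
theorem sum_card_zeros_after_gapSupport {c d : ℕ} (had : a + 2 ≤ d) (hdk : d ≤ k) (hkb : k ≤ b)
    (hb : b + 2 ≤ n) :
    ∑ x ∈ Finset.Ico c a ∪ Finset.Ico d k ∪ Finset.Ico b (b + 2),
      ((Finset.range n \ gapSupport a k b).filter (x < ·)).card =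
      (a - c) * (n - k) + (k - d) * (n - k - 2) + 2 * (n - b - 2) := by
  rw [sum_gapSupport (by omega) hdk hkb,
    Finset.sum_const_nat (m := n - k), Finset.sum_const_nat (m := n - k - 2),
    Finset.sum_const_nat (m := n - b - 2)]
  · simp
  all_goals
    intro x hx
    rw [Finset.mem_Ico] at hx
  · exact card_zeros_after_gapSupport_of_le (by omega) hkb hx.1 hx.2
  · exact card_zeros_after_gapSupport_of_lt hkb hb (by omega) hx.2
  · exact card_zeros_after_gapSupport_of_lt_left (by omega) hkb hb hx.2

/-- The first row of the Ferrers diagram of each identifying vector has at least `k` dots. -/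
theorem exists_first_row_of_mem_supports (hk : 4 ≤ k) (hn : 2 * k + 2 ≤ n) {S : Finset ℕ}
    (hS : S ∈ supports n k) : ∃ r₀ : Ones (indicatorVec n S), (∀ r, r₀ ≤ r) ∧
      k ≤ Nat.card {c // (r₀, c) ∈ ferrersDiagram (indicatorVec n S)} := by
  suffices ∃ a₀ ∈ S, (∀ a ∈ S, a₀ ≤ a) ∧
      k ≤ ((Finset.range n \ S).filter (a₀ < ·)).card by
    obtain ⟨a₀, ha₀, hmin, hle⟩ := this
    have hlt := Finset.mem_range.mp (subset_range_of_mem_supports (by omega) hS ha₀)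
    refine ⟨⟨⟨a₀, hlt⟩, indicatorVec_eq_true.mpr ha₀⟩,
      fun r => hmin _ (indicatorVec_eq_true.mp r.2), ?_⟩
    rwa [card_row_indicatorVec]
  rcases mem_supports.mp hS with rfl | ⟨i, l, hi, hl, rfl⟩
  · refine ⟨0, by rw [Finset.mem_range]; omega, fun _ _ => Nat.zero_le _, ?_⟩
    rw [card_zeros_after_range (by omega)]
    omega
  · rcases Nat.eq_zero_or_pos (k - 2 * i - 2) with h0 | h0
    · rw [h0]
      refine ⟨2, by rw [mem_gapSupport]; omega, fun a ha => ?_, ?_⟩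
      · rw [mem_gapSupport] at ha
        omega
      · rw [card_zeros_after_gapSupport_of_lt (by omega) (by omega) (by omega) (by omega)]
        omega
    · refine ⟨0, by rw [mem_gapSupport]; omega, fun _ _ => Nat.zero_le _, ?_⟩
      rw [card_zeros_after_gapSupport_of_lt_left (by omega) (by omega) (by omega) h0]
      omega

theorem dotsOutside_range (hk : 0 < k) (hkn : k ≤ n) :
    dotsOutside (indicatorVec n (Finset.range k)) 2 1 = (k - 1) * (n - k) := by
  have hr₀ : indicatorVec n (Finset.range k) ⟨0, by omega⟩ = true := by
    simp [indicatorVec, hk]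
  rw [dotsOutside_two_one_indicatorVec (Finset.range_mono hkn) (r₀ := ⟨_, hr₀⟩)
    (fun r => Fin.le_def.mpr (Nat.zero_le _)), Finset.sum_const_nat (m := n - k)]
  · rw [Finset.card_erase_of_mem (by simpa using hk), Finset.card_range]
  · intro x hx
    exact card_zeros_after_range (Finset.mem_range.mp (Finset.mem_of_mem_erase hx))

theorem dotsOutside_gapSupport_of_pos (ha : 0 < a) (hak : a + 2 ≤ k) (hkb : k ≤ b)
    (hb : b + 2 ≤ n) : dotsOutside (indicatorVec n (gapSupport a k b)) 2 1 =
      (a - 1) * (n - k) + (k - (a + 2)) * (n - k - 2) + 2 * (n - b - 2) := by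
  have hr₀ : indicatorVec n (gapSupport a k b) ⟨0, by omega⟩ = true := by
    rw [indicatorVec_eq_true, mem_gapSupport]
    simp only
    omega
  rw [dotsOutside_two_one_indicatorVec (r₀ := ⟨_, hr₀⟩) _ fun r => Fin.le_def.mpr (Nat.zero_le _)]
  · rw [← sum_card_zeros_after_gapSupport le_rfl hak hkb hb]
    refine Finset.sum_congr ?_ fun _ _ => rfl
    ext x
    simp only [Finset.mem_erase, Finset.mem_union, Finset.mem_Ico, mem_gapSupport]
    omega
  · intro x hx
    rw [mem_gapSupport] at hx
    rw [Finset.mem_range]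
    omega

theorem dotsOutside_gapSupport_zero (hk : 3 ≤ k) (hkb : k ≤ b) (hb : b + 2 ≤ n) :
    dotsOutside (indicatorVec n (gapSupport 0 k b)) 2 1 =
      (k - 3) * (n - k - 2) + 2 * (n - b - 2) := by
  have hr₀ : indicatorVec n (gapSupport 0 k b) ⟨2, by omega⟩ = true := by
    rw [indicatorVec_eq_true, mem_gapSupport]
    simp only
    omega
  rw [dotsOutside_two_one_indicatorVec (r₀ := ⟨_, hr₀⟩)]
  · have := sum_card_zeros_after_gapSupport (a := 0) (c := 0) (d := 3) (by omega) hk hkb hb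
    rw [Nat.sub_zero, zero_mul, zero_add] at this
    rw [← this]
    refine Finset.sum_congr ?_ fun _ _ => rfl
    ext x
    simp only [Finset.mem_erase, Finset.mem_union, Finset.mem_Ico, mem_gapSupport]
    omega
  · intro x hx
    rw [mem_gapSupport] at hx
    rw [Finset.mem_range]
    omega
  · intro r
    have := indicatorVec_eq_true.mp r.2
    rw [mem_gapSupport] at this
    exact Fin.le_def.mpr (by simp only; omega)

/-- The number of codewords of the lifted codes of the vectors `(u || v)`. -/
theorem sum_pow_dotsOutside_gapSupport (q : ℕ) (hk : 4 ≤ k) :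
    ∑ p ∈ Finset.range (k / 2) ×ˢ Finset.range ((n - k) / 2),
      q ^ dotsOutside (indicatorVec n (gapSupport (k - 2 * p.1 - 2) k (k + 2 * p.2))) 2 1 =
    (∑ i ∈ Finset.range ((k - 3) / 2 + 1), q ^ ((k - 3) * (n - k) - 4 * i) +
        eps (k - 1) * q ^ ((k - 3) * (n - k - 2))) *
      ∑ i ∈ Finset.range ((n - k) / 2), q ^ (2 * (2 * i + eps (n - k))) := by
  -- In the formula the pairs of ones are counted from the right end, in `supports` from the left.
  have hreflect : ∑ l ∈ Finset.range ((n - k) / 2), q ^ (2 * (2 * l + eps (n - k))) =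
      ∑ l ∈ Finset.range ((n - k) / 2), q ^ (2 * (n - (k + 2 * l) - 2)) := by
    rw [← Finset.sum_range_reflect]
    refine Finset.sum_congr rfl fun l hl => ?_
    rw [Finset.mem_range] at hl
    congr 2
    unfold eps
    split_ifs with h
    · rw [Nat.odd_iff] at h
      omega
    · rw [Nat.not_odd_iff] at h
      omega
  have hpos : ∀ i l, 2 * i + 3 ≤ k → l < (n - k) / 2 →
      q ^ dotsOutside (indicatorVec n (gapSupport (k - 2 * i - 2) k (k + 2 * l))) 2 1 =
        q ^ ((k - 3) * (n - k) - 4 * i) * q ^ (2 * (n - (k + 2 * l) - 2)) := by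
    intro i l hi hl
    rw [dotsOutside_gapSupport_of_pos (by omega) (by omega) (by omega) (by omega), ← pow_add]
    congr 2
    obtain ⟨t, rfl⟩ := Nat.exists_eq_add_of_le hi
    obtain ⟨m, hm⟩ : ∃ m, n - (2 * i + 3 + t) = m + 2 := ⟨n - (2 * i + 3 + t) - 2, by omega⟩
    rw [hm, show 2 * i + 3 + t - 2 * i - 2 - 1 = t by omega,
      show 2 * i + 3 + t - (2 * i + 3 + t - 2 * i - 2 + 2) = 2 * i by omega,
      show 2 * i + 3 + t - 3 = 2 * i + t by omega, Nat.add_sub_cancel]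
    refine (Nat.sub_eq_of_eq_add ?_).symm
    ring
  have hzero : ∀ i l, k = 2 * i + 2 → l < (n - k) / 2 →
      q ^ dotsOutside (indicatorVec n (gapSupport (k - 2 * i - 2) k (k + 2 * l))) 2 1 =
        q ^ ((k - 3) * (n - k - 2)) * q ^ (2 * (n - (k + 2 * l) - 2)) := by
    intro i l hi hl
    rw [show k - 2 * i - 2 = 0 by omega,
      dotsOutside_gapSupport_zero (by omega) (by omega) (by omega), pow_add]
  rw [Finset.sum_product, hreflect]
  rcases Nat.even_or_odd k with he | ho
  · obtain ⟨i₀, rfl⟩ : ∃ i₀, k = 2 * i₀ + 2 := by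
      obtain ⟨t, rfl⟩ := he
      exact ⟨t - 1, by omega⟩
    have heps : eps (2 * i₀ + 2 - 1) = 1 := if_pos ⟨i₀, by omega⟩
    rw [heps, one_mul, show (2 * i₀ + 2) / 2 = i₀ + 1 by omega,
      show (2 * i₀ + 2 - 3) / 2 + 1 = i₀ by omega, Finset.sum_range_succ, add_mul]
    congr 1
    · rw [Finset.sum_mul_sum]
      refine Finset.sum_congr rfl fun i hi => Finset.sum_congr rfl fun l hl => ?_
      rw [Finset.mem_range] at hi hl
      exact hpos i l (by omega) hl
    · rw [Finset.mul_sum]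
      exact Finset.sum_congr rfl fun l hl => hzero i₀ l rfl (Finset.mem_range.mp hl)
  · have heps : eps (k - 1) = 0 := by
      rw [eps, if_neg]
      rw [Nat.odd_iff] at ho ⊢
      omega
    rw [Nat.odd_iff] at ho
    rw [heps, zero_mul, add_zero, show (k - 3) / 2 + 1 = k / 2 by omega, Finset.sum_mul_sum]
    refine Finset.sum_congr rfl fun i hi => Finset.sum_congr rfl fun l hl => ?_
    rw [Finset.mem_range] at hi hl
    exact hpos i l (by omega) hl

end Dimension


/-! ### The union of the lifted codes -/

section Union

variable {K : Type*} [Field K] {n k : ℕ}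

theorem two_le_injectionDist {X Y : Submodule K (Fin n → K)} (hX : X ∈ grassmannian K n k)
    (h : Module.finrank K (X ⊓ Y : Submodule K (Fin n → K)) + 2 ≤ k) : 2 ≤ injectionDist X Y := by
  have hX' : Module.finrank K X = k := hX
  rw [injectionDist]
  omega

/-- Codewords with different identifying vectors. -/
theorem finrank_inf_add_two_le_of_ne (hkn : k ≤ n) {S S' : Finset ℕ} (hS : S ∈ supports n k)
    (hS' : S' ∈ supports n k) (hne : S ≠ S')
    {𝒞 : Submodule K (Matrix (Ones (indicatorVec n S)) (Zeros (indicatorVec n S)) K)}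
    {𝒞' : Submodule K (Matrix (Ones (indicatorVec n S')) (Zeros (indicatorVec n S')) K)}
    {X Y : Submodule K (Fin n → K)} (hX : X ∈ liftedCode k _ 𝒞) (hY : Y ∈ liftedCode k _ 𝒞') :
    Module.finrank K (X ⊓ Y : Submodule K (Fin n → K)) + 2 ≤ k := by
  obtain ⟨-, E, hE, -⟩ := hX
  obtain ⟨-, E', hE', -⟩ := hY
  refine le_trans ?_ (card_inter_supports_add_two_le hS hS' hne)
  have h := finrank_inf_le_card hE hE'
  have hsub : S ∩ S' ⊆ Finset.range n :=
    Finset.inter_subset_left.trans (subset_range_of_mem_supports hkn hS)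
  rw [← card_filter_fin hsub]
  simpa [indicatorVec] using h

/-- Codewords with the same identifying vector. -/
theorem finrank_inf_add_two_le_of_mem_liftedCode {v : Fin n → Bool}
    (hv : Fintype.card (Ones v) = k) {ρ : ℕ} {𝒞 : Submodule K (Matrix (Ones v) (Zeros v) K)}
    (h𝒞 : IsFDRM v ρ 2 𝒞) {X Y : Submodule K (Fin n → K)} (hX : X ∈ liftedCode k v 𝒞)
    (hY : Y ∈ liftedCode k v 𝒞) (hne : X ≠ Y) :
    Module.finrank K (X ⊓ Y : Submodule K (Fin n → K)) + 2 ≤ k := by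
  obtain ⟨-, E, hE, hEC⟩ := hX
  obtain ⟨-, E', hE', hEC'⟩ := hY
  have h := finrank_inf_add_rank_le hE hE'
  have hr := h𝒞.2.2 _ hEC _ hEC' fun h' => hne <| by
    rw [← hE.2, ← hE'.2, hE.1.eq_echelonMatrix, hE'.1.eq_echelonMatrix, h']
  omega

/-- A codeword of a lifted code and a subspace of the last `n - k` coordinates. -/
theorem finrank_inf_map_prependZeros_add_two_le (hk : 4 ≤ k) (hkn : k ≤ n) {S : Finset ℕ}
    (hS : S ∈ supports n k)
    {𝒞 : Submodule K (Matrix (Ones (indicatorVec n S)) (Zeros (indicatorVec n S)) K)}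
    {X : Submodule K (Fin n → K)} (hX : X ∈ liftedCode k _ 𝒞)
    (Y : Submodule K (Fin (n - k) → K)) :
    Module.finrank K (X ⊓ Y.map (prependZeros K n k) : Submodule K (Fin n → K)) + 2 ≤ k := by
  obtain ⟨-, E, hE, -⟩ := hX
  have h := finrank_inf_map_prependZeros_le hE Y
  have h2 := card_filter_le_two_of_mem_supports hS
  have hsub : S.filter (k ≤ ·) ⊆ Finset.range n :=
    (Finset.filter_subset _ _).trans (subset_range_of_mem_supports hkn hS)
  rw [← card_filter_fin hsub] at h2
  simp only [indicatorVec_eq_true] at h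
  simp only [Finset.mem_filter] at h2
  omega

/-- The number of codewords of the union of the lifted codes. -/
theorem ncard_iUnion_liftedCode [Finite K] (hk : 4 ≤ k) (hn : 2 * k + 2 ≤ n)
    {F : (v : Fin n → Bool) → Submodule K (Matrix (Ones v) (Zeros v) K)}
    (hF : ∀ S ∈ supports n k, IsFDRM (indicatorVec n S) (dotsOutside (indicatorVec n S) 2 1) 2
      (F (indicatorVec n S))) :
    (⋃ S ∈ supports n k, liftedCode k (indicatorVec n S) (F (indicatorVec n S))).ncard =
      Nat.card K ^ ((k - 1) * (n - k)) +
        (∑ i ∈ Finset.range ((k - 3) / 2 + 1), Nat.card K ^ ((k - 3) * (n - k) - 4 * i) +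
          eps (k - 1) * Nat.card K ^ ((k - 3) * (n - k - 2))) *
        ∑ i ∈ Finset.range ((n - k) / 2), Nat.card K ^ (2 * (2 * i + eps (n - k))) := by
  have hfin : Finite (Submodule K (Fin n → K)) := Finite.of_injective _ SetLike.coe_injective
  have hunion := (supports n k).finite_toSet.ncard_biUnion
    (s := fun S => liftedCode k (indicatorVec n S) (F (indicatorVec n S)))
    (fun _ _ => Set.toFinite _) (by
      intro S hS S' hS' hne
      rw [Function.onFun, Set.disjoint_left]
      intro X hX hX'
      have h := finrank_inf_add_two_le_of_ne (by omega) hS hS' hne hX hX'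
      have hX'' : Module.finrank K X = k := hX.1
      rw [inf_idem] at h
      omega)
  simp only [Finset.mem_coe] at hunion
  rw [hunion, finsum_mem_finset_eq_sum, Finset.sum_congr rfl fun S hS =>
      ncard_liftedCode (hF S hS) ((card_ones_indicatorVec
        (subset_range_of_mem_supports (by omega) hS)).trans (card_of_mem_supports hS)),
    supports, Finset.sum_insert range_notMem_image_gapSupport,
    Finset.sum_image gapSupport_injOn, dotsOutside_range (by omega) (by omega),
    sum_pow_dotsOutside_gapSupport _ hk]

end Union

end SubspaceCode

theorem mainTheorem4 {K : Type*} [Field K] [Finite K] (q n k : ℕ) (hq : Nat.card K = q)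
    (hk : 4 ≤ k) (hn : 2 * k + 2 ≤ n) :
    (∃ F : (v : Fin n → Bool) → Submodule K (Matrix (Ones v) (Zeros v) K),
      ∀ v ∈ identifyingVectors n k, IsFDMRD v 2 (F v)) ∧
    ∀ F : (v : Fin n → Bool) → Submodule K (Matrix (Ones v) (Zeros v) K),
      (∀ v ∈ identifyingVectors n k, IsFDMRD v 2 (F v)) →
      ∀ (M : ℕ) (D : Set (Submodule K (Fin (n - k) → K))), IsCDCode (n - k) M 2 k D →
        IsCDCode n
          (q ^ ((k - 1) * (n - k)) + M +
            (∑ i ∈ Finset.range ((k - 3) / 2 + 1), q ^ ((k - 3) * (n - k) - 4 * i) +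
                eps (k - 1) * q ^ ((k - 3) * (n - k - 2))) *
              ∑ i ∈ Finset.range ((n - k) / 2), q ^ (2 * (2 * i + eps (n - k))))
          2 k (constructionB n k F D) := by
  subst hq
  have hkn : k ≤ n := by omega
  have hones : ∀ S ∈ supports n k, Fintype.card (Ones (indicatorVec n S)) = k := fun S hS =>
    (card_ones_indicatorVec (subset_range_of_mem_supports hkn hS)).trans (card_of_mem_supports hS)
  have hiff : ∀ P : (Fin n → Bool) → Prop,
      (∀ v ∈ identifyingVectors n k, P v) ↔ ∀ S ∈ supports n k, P (indicatorVec n S) := by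
    intro P
    rw [identifyingVectors_eq_image]
    exact Set.forall_mem_image
  constructor
  · classical
    have hex : ∀ v ∈ identifyingVectors n k,
        ∃ 𝒞 : Submodule K (Matrix (Ones v) (Zeros v) K), IsFDMRD v 2 𝒞 := by
      rw [hiff fun v => ∃ 𝒞 : Submodule K (Matrix (Ones v) (Zeros v) K), IsFDMRD v 2 𝒞]
      intro S hS
      obtain ⟨r₀, hr₀, hcard⟩ := exists_first_row_of_mem_supports hk hn hS
      exact exists_isFDMRD_two K hr₀ ((hones S hS).trans_le hcard)
    exact ⟨fun v => if hv : v ∈ identifyingVectors n k then (hex v hv).choose else ⊥,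
      fun v hv => by simpa only [hv, dite_true] using (hex v hv).choose_spec⟩
  · intro F hF M D hD
    obtain ⟨hDdim, hDcard, hDmin⟩ := hD
    rw [hiff fun v => IsFDMRD v 2 (F v)] at hF
    have hF' : ∀ S ∈ supports n k, IsFDRM (indicatorVec n S)
        (dotsOutside (indicatorVec n S) 2 1) 2 (F (indicatorVec n S)) := by
      intro S hS
      obtain ⟨r₀, hr₀, hcard⟩ := exists_first_row_of_mem_supports hk hn hS
      exact (hF S hS).isFDRM_two hr₀ ((hones S hS).trans_le hcard)
    have hcode : constructionB n k F D =
        (⋃ S ∈ supports n k, liftedCode k (indicatorVec n S) (F (indicatorVec n S))) ∪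
          (fun Y => Submodule.map (prependZeros K n k) Y) '' D := by
      rw [constructionB, identifyingVectors_eq_image, Set.biUnion_image]
      rfl
    have hinj : Function.Injective fun Y => Submodule.map (prependZeros K n k) Y :=
      Submodule.map_injective_of_injective (prependZeros_injective K n k)
    have hgrass : constructionB n k F D ⊆ grassmannian K n k := by
      rw [hcode]
      rintro X (hX | ⟨Y, hY, rfl⟩)
      · simp only [Set.mem_iUnion] at hX
        obtain ⟨S, -, hX⟩ := hX
        exact hX.1
      · exact (finrank_map_prependZeros Y).trans (hDdim hY)
    refine ⟨hgrass, ?_, ?_, ?_⟩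
    · have hfin : Finite (Submodule K (Fin n → K)) := Finite.of_injective _ SetLike.coe_injective
      rw [hcode, Set.ncard_union_eq _ (Set.toFinite _) (Set.toFinite _),
        ncard_iUnion_liftedCode hk hn hF', Set.ncard_image_of_injective _ hinj, hDcard,
        add_right_comm]
      rw [Set.disjoint_left]
      rintro X hX ⟨Y, -, rfl⟩
      simp only [Set.mem_iUnion] at hX
      obtain ⟨S, hS, hX⟩ := hX
      have h := finrank_inf_map_prependZeros_add_two_le hk hkn hS hX Y
      have hX' : Module.finrank K (Y.map (prependZeros K n k)) = k := hX.1
      rw [inf_idem] at h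
      omega
    · -- The distance two is attained in `D`.
      obtain ⟨X, hX, Y, hY, hne, hdist⟩ := hDmin.1
      rw [hcode]
      exact ⟨_, Or.inr ⟨X, hX, rfl⟩, _, Or.inr ⟨Y, hY, rfl⟩, hinj.ne hne,
        (injectionDist_map_prependZeros X Y).trans hdist⟩
    · rintro _ ⟨X, hX, Y, hY, hne, rfl⟩
      have hXk := hgrass hX
      rw [hcode] at hX hY
      simp only [Set.mem_union, Set.mem_iUnion] at hX hY
      rcases hX with ⟨S, hS, hX⟩ | ⟨X, hX, rfl⟩ <;> rcases hY with ⟨S', hS', hY⟩ | ⟨Y, hY, rfl⟩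
      · refine two_le_injectionDist hXk ?_
        by_cases hSS : S = S'
        · subst hSS
          exact finrank_inf_add_two_le_of_mem_liftedCode (hones S hS) (hF' S hS) hX hY hne
        · exact finrank_inf_add_two_le_of_ne hkn hS hS' hSS hX hY
      · exact two_le_injectionDist hXk (finrank_inf_map_prependZeros_add_two_le hk hkn hS hX Y)
      · refine two_le_injectionDist hXk ?_
        rw [inf_comm]
        exact finrank_inf_map_prependZeros_add_two_le hk hkn hS' hY X
      · simp only [injectionDist_map_prependZeros]
        exact hDmin.2 ⟨X, hX, Y, hY, fun h => hne (by rw [h]), rfl⟩
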